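/- For $\alpha\in\mathbb R$, $\alpha\neq 0$, the Gegenbauer polynomials $P^\alpha_d$ of order $\alpha$ are defined by $P^\alpha_0(t)=1$, $P^\alpha_1(t)=2\alpha t$ and $$d\,P^\alpha_d(t)=2t(d+\alpha-1)P^\alpha_{d-1}(t)-(d+2\alpha-2)P^\alpha_{d-2}(t)\qquad(d\ge 2);$$ for $\alpha=0$ let $P^0_d=T_d$ be the Chebyshev polynomial of the first kind. For $Z=[z_1,\dots,z_r]\in(S^{n-1})^r$, let $\Pi_Z$ be the orthogonal projection of $\mathbb R^n$ onto the span $\mathcal R(Z)$ of $z_1,\dots,z_r$, let $\Pi_Z^\perp=I-\Pi_Z$, and put $$\langle x,y\rangle_Z:=(\Pi_Z^\perp x)^{\top}\,\Pi_Z^\perp y,$$ which equals $x^{\top}y-(Z^{\top}x)^{\top}(Z^{\top}Z)^{-1}Z^{\top}y$ when $z_1,\dots,z_r$ are linearly independent. For $q\in S^{n-1}$ let $[Z\,q]=[z_1,\dots,z_r,q]$. Proposition 4. Let $r\ge 0$ and $n\ge r+3$ be integers. There are positive constants $c^{n,r}_{k,i}$ $(0\le i\le k)$, depending only on $n,r,k,i$,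 such that for all $k\ge 0$, all $Z\in(S^{n-1})^r$ and all $x,y,q\in S^{n-1}\setminus\mathcal R(Z)$, $$\begin{aligned} P_k^{\frac{n-r}{2}-1}\!\left(\frac{\langle x,y\rangle_Z}{\sqrt{\langle x,x\rangle_Z}\sqrt{\langle y,y\rangle_Z}}\right) =\sum_{i=0}^k c^{n,r}_{k,i} &\left(\frac{\langle x,x\rangle_{[Zq]}}{\langle x,x\rangle_Z}\right)^{i/2} \left(\frac{\langle y,y\rangle_{[Zq]}}{\langle y,y\rangle_Z}\right)^{i/2} P_i^{\frac{n-r}{2}-\frac32}\!\left(\frac{\langle x,y\rangle_{[Zq]}}{\sqrt{\langle x,x\rangle_{[Zq]}}\sqrt{\langle y,y\rangle_{[Zq]}}}\right)\\ &\cdot P_{k-i}^{\frac{n-r}{2}+i-1}\!\left(\frac{\langle x,q\rangle_Z}{\sqrt{\langle x,x\rangle_Z}\sqrt{\langle q,q\rangle_Z}}\right) P_{k-i}^{\frac{n-r}{2}+i-1}\!\left(\frac{\langle y,q\rangle_Z}{\sqrt{\langle y,y\rangle_Z}\sqrt{\langle q,q\rangle_Z}}\right). \end{aligned}$$ Here a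 $0$-th power is $1$, and if $x$ or $y$ lies in $\mathcal R([Z\,q])$, the undefined argument of $P_i^{\frac{n-r}{2}-\frac32}$ is read as $0$ (its value is irrelevant: for $i\ge1$ that term carries a factor $0$). -/

import Mathlib

noncomputable section

/-- The polynomials given by the three-term recursion
`P 0 = 1`, `P 1 = 2 α t`, `d P d = 2 t (d + α - 1) P (d - 1) - (d + 2 α - 2) P (d - 2)`. -/
def gegenbauerRec (α : ℝ) : ℕ → Polynomial ℝ
  | 0 => 1
  | 1 => Polynomial.C (2 * α) * Polynomial.X
  | d + 2 =>
    Polynomial.C (((d + 2 : ℕ) : ℝ)⁻¹) *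
      (Polynomial.C (2 * (((d + 2 : ℕ) : ℝ) + α - 1)) * Polynomial.X * gegenbauerRec α (d + 1)
        - Polynomial.C (((d + 2 : ℕ) : ℝ) + 2 * α - 2) * gegenbauerRec α d)

/-- The Gegenbauer polynomial of order `α` and degree `d`. At `α = 0` the recursion degenerates
(it returns `0` in every degree `d ≥ 1`), and the Gegenbauer polynomial of order `0` is, as usual,
the Chebyshev polynomial of the first kind. -/
def gegenbauer (α : ℝ) (d : ℕ) : Polynomial ℝ :=
  if α = 0 then Polynomial.Chebyshev.T ℝ (d : ℤ) else gegenbauerRec α d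

/-- `⟨x, y⟩_Z`: the inner product of the orthogonal projections of `x` and `y` onto the orthogonal
complement of the range `R(Z)` of `Z = [z_1, …, z_r]`, i.e. of the span of its columns. -/
def projInner {n r : ℕ} (Z : Fin r → EuclideanSpace ℝ (Fin n)) (x y : EuclideanSpace ℝ (Fin n)) :
    ℝ :=
  inner ℝ ((Submodule.span ℝ (Set.range Z))ᗮ.starProjection x)
    ((Submodule.span ℝ (Set.range Z))ᗮ.starProjection y)

/-- `[Z q]`: the tuple `Z` with one more column `q` at the end. -/
def augment {n r : ℕ} (Z : Fin r → EuclideanSpace ℝ (Fin n)) (q : EuclideanSpace ℝ (Fin n)) :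
    Fin (r + 1) → EuclideanSpace ℝ (Fin n) :=
  Fin.snoc (α := fun _ => EuclideanSpace ℝ (Fin n)) Z q

/-- The `n × r` matrix with columns `Z 0, …, Z (r - 1)`. -/
def colMatrix {n r : ℕ} (Z : Fin r → EuclideanSpace ℝ (Fin n)) : Matrix (Fin n) (Fin r) ℝ :=
  Matrix.of fun a j => Z j a

open scoped Matrix in
/-- For linearly independent columns, `⟨x, y⟩_Z = xᵀ y - (Zᵀ x)ᵀ (Zᵀ Z)⁻¹ Zᵀ y`. -/
theorem projInner_eq_matrix {n r : ℕ} (Z : Fin r → EuclideanSpace ℝ (Fin n))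
    (hZ : LinearIndependent ℝ Z) (x y : EuclideanSpace ℝ (Fin n)) :
    projInner Z x y = x.ofLp ⬝ᵥ y.ofLp
      - ((colMatrix Z)ᵀ *ᵥ x.ofLp) ⬝ᵥ
          (((colMatrix Z)ᵀ * colMatrix Z)⁻¹ *ᵥ ((colMatrix Z)ᵀ *ᵥ y.ofLp)) := by
  set M := colMatrix Z with hM
  have hdet : IsUnit (Mᵀ * M).det := by
    have h : Matrix.gram ℝ Z = Mᵀ * M := by
      ext i j
      simp [Matrix.gram, Matrix.mul_apply, hM, colMatrix, PiLp.inner_apply, mul_comm]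
    rw [← h]
    exact isUnit_iff_ne_zero.mpr (Matrix.det_gram_ne_zero_iff_linearIndependent.mpr hZ)
  set w : Fin r → ℝ := (Mᵀ * M)⁻¹ *ᵥ (Mᵀ *ᵥ y.ofLp) with hw
  set p : EuclideanSpace ℝ (Fin n) := ∑ j, w j • Z j with hp
  have hpv : p.ofLp = M *ᵥ w := by
    ext a
    simp [hp, Matrix.mulVec, dotProduct, hM, colMatrix, mul_comm]
  have hpmem : p ∈ Submodule.span ℝ (Set.range Z) :=
    Submodule.sum_mem _ fun j _ => Submodule.smul_mem _ _ (Submodule.subset_span ⟨j, rfl⟩)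
  have hnorm : Mᵀ *ᵥ (M *ᵥ w) = Mᵀ *ᵥ y.ofLp := by
    rw [Matrix.mulVec_mulVec, hw, Matrix.mulVec_mulVec, Matrix.mul_nonsing_inv _ hdet,
      Matrix.one_mulVec]
  have hinner : ∀ (j : Fin r) (v : EuclideanSpace ℝ (Fin n)),
      inner ℝ (Z j) v = (Mᵀ *ᵥ v.ofLp) j := by
    intro j v
    simp [Matrix.mulVec, dotProduct, hM, colMatrix, PiLp.inner_apply, mul_comm]
  have horth : y - p ∈ (Submodule.span ℝ (Set.range Z))ᗮ := by
    rw [Submodule.mem_orthogonal]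
    intro u hu
    induction hu using Submodule.span_induction with
    | mem u hu =>
      obtain ⟨j, rfl⟩ := hu
      rw [inner_sub_right, hinner, hinner, hpv, hnorm, sub_self]
    | zero => simp
    | add u v _ _ h1 h2 => rw [inner_add_left, h1, h2, add_zero]
    | smul c u _ h => rw [inner_smul_left, h, mul_zero]
  have hproj : (Submodule.span ℝ (Set.range Z))ᗮ.starProjection y = y - p := by
    rw [Submodule.starProjection_orthogonal_val]
    rw [Submodule.eq_starProjection_of_mem_orthogonal hpmem horth]
  have h1 : projInner Z x y = inner ℝ x (y - p) := by
    unfold projInner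
    rw [Submodule.inner_starProjection_left_eq_right, hproj,
      Submodule.starProjection_eq_self_iff.mpr horth]
  rw [h1, inner_sub_right]
  have h2 : ∀ u v : EuclideanSpace ℝ (Fin n), inner ℝ u v = u.ofLp ⬝ᵥ v.ofLp := by
    intro u v
    simp [PiLp.inner_apply, dotProduct, mul_comm]
  rw [h2, h2, hpv, Matrix.dotProduct_mulVec, Matrix.mulVec_transpose]

end

/-!
Projecting onto the orthogonal complement of the span of `Z` and normalizing turns `x`, `y`, `q`
into unit vectors with mutual cosines `c = cos(x, y)`, `a = cos(x, q)`, `b = cos(y, q)`. Replacing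
`Z` by `[Z q]` is one more Gram–Schmidt step, so that the ratios of the squared lengths are
`1 - a²` and `1 - b²`, and the spherical law of cosines reads `c = a b + √(1 - a²) √(1 - b²) t`
with `t` the argument of the polynomial of order `μ = (n - r)/2 - 3/2`
(`projInner_law_of_cosines`). With `α = μ + 1/2` the claim is therefore the classical addition
formula (`gegenbauerRec_addition`)
`C_k^α(a b + g t) = ∑ i ≤ k, (k-i)! / (2α)_{k+i} * D^i C_k^α(a) * D^i C_k^α(b) * E_i`,
where `g = √(1 - a²) √(1 - b²)`, `D^i C_k^α = 2^i (α)_i C_{k-i}^{α+i}` is the `i`-th derivative, and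
`E_i = g^i (i + μ)/μ C_i^μ(t)`. As `μ → 0`, the polynomial
`(i + μ)/μ C_i^μ` tends to `2 T_i` for `i ≥ 1` and to `1` for `i = 0`, so with these values the
Chebyshev case is covered as well.

The addition formula is proved by induction on `k` through the three-term recursion of `C_k^α`.
Multiplication by `g t` acts on the `E_i` by their own three-term recursion
(`mul_angularFactor_succ`), so it suffices to compare the coefficients of each `E_i`
(`additionCoeff_rec`). The relations between orders `ν` and `ν + 1`
(`gegenbauerRec_raise_sub`, `gegenbauerRec_lower`), together with the recursion in the degree,
express every product occurring there through degrees `k - i` and `k - i - 2` of the single order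
`α + i`, and what remains is an identity between rational functions of `k`, `i` and `α`.
-/

open Polynomial

/-! ### Relations between Gegenbauer polynomials of consecutive orders -/

theorem gegenbauerRec_zero_eval (ν x : ℝ) : (gegenbauerRec ν 0).eval x = 1 := by
  simp [gegenbauerRec]

theorem gegenbauerRec_one_eval (ν x : ℝ) : (gegenbauerRec ν 1).eval x = 2 * ν * x := by
  simp [gegenbauerRec]

theorem gegenbauerRec_succ_succ_eval (ν x : ℝ) (j : ℕ) :
    ((j : ℝ) + 2) * (gegenbauerRec ν (j + 2)).eval x =
      2 * (j + 1 + ν) * x * (gegenbauerRec ν (j + 1)).eval x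
        - (j + 2 * ν) * (gegenbauerRec ν j).eval x := by
  have h : (j : ℝ) + 2 ≠ 0 := by positivity
  rw [gegenbauerRec]
  simp only [eval_mul, eval_sub, eval_C, eval_X]
  push_cast
  field_simp
  ring

/-- The raising relations `d C_d^ν = 2ν (x C_{d-1}^{ν+1} - C_{d-2}^{ν+1})` and
`(d + 2ν) C_d^ν = 2ν (C_d^{ν+1} - x C_{d-1}^{ν+1})` in degree `d = j + 2`. They are proved together,
because the recursion turns both relations in two consecutive degrees into the first one in the
next degree, and the recursion for `C^{ν+1}` makes the two relations equivalent. -/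
theorem gegenbauerRec_raise (ν x : ℝ) (j : ℕ) :
    ((j : ℝ) + 2) * (gegenbauerRec ν (j + 2)).eval x =
        2 * ν * (x * (gegenbauerRec (ν + 1) (j + 1)).eval x - (gegenbauerRec (ν + 1) j).eval x) ∧
      ((j : ℝ) + 2 + 2 * ν) * (gegenbauerRec ν (j + 2)).eval x =
        2 * ν * ((gegenbauerRec (ν + 1) (j + 2)).eval x
          - x * (gegenbauerRec (ν + 1) (j + 1)).eval x) := by
  induction j using Nat.strong_induction_on with
  | _ j ih =>
    have hne : (j : ℝ) + 2 ≠ 0 := by positivity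
    have hU := gegenbauerRec_succ_succ_eval (ν + 1) x j
    have hC := gegenbauerRec_succ_succ_eval ν x j
    have first : ((j : ℝ) + 2) * (gegenbauerRec ν (j + 2)).eval x =
        2 * ν * (x * (gegenbauerRec (ν + 1) (j + 1)).eval x
          - (gegenbauerRec (ν + 1) j).eval x) := by
      match j, ih, hC with
      | 0, _, hC =>
        simp only [zero_add, gegenbauerRec_zero_eval, gegenbauerRec_one_eval] at hC ⊢
        rw [hC]
        push_cast
        ring
      | 1, ih, hC =>
        obtain ⟨h1, h2⟩ := ih 0 (by norm_num)
        simp only [zero_add, gegenbauerRec_zero_eval, gegenbauerRec_one_eval, Nat.reduceAdd]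
          at hC h1 h2 ⊢
        push_cast at hC h1 h2 ⊢
        linear_combination hC + x * h1 + x * h2
      | m + 2, ih, hC =>
        obtain ⟨-, h0⟩ := ih m (by omega)
        obtain ⟨h1, h2⟩ := ih (m + 1) (by omega)
        push_cast at hC h0 h1 h2 ⊢
        linear_combination hC + x * h1 + x * h2 - h0
    refine ⟨first, mul_left_cancel₀ hne ?_⟩
    linear_combination ((j : ℝ) + 2 + 2 * ν) * first - 2 * ν * hU

/-- `(d + ν) C_d^ν = ν (C_d^{ν+1} - C_{d-2}^{ν+1})` in degree `d = j + 2`. -/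
theorem gegenbauerRec_raise_sub (ν x : ℝ) (j : ℕ) :
    ((j : ℝ) + 2 + ν) * (gegenbauerRec ν (j + 2)).eval x =
      ν * ((gegenbauerRec (ν + 1) (j + 2)).eval x - (gegenbauerRec (ν + 1) j).eval x) := by
  obtain ⟨h1, h2⟩ := gegenbauerRec_raise ν x j
  linear_combination (h1 + h2) / 2

/-- `4ν (j + 1 + ν) (1 - x²) C_j^{ν+1}` as a combination of `C_j^ν` and `C_{j+2}^ν`: the factor
`1 - x²` undoes the raising of the order. -/
theorem gegenbauerRec_lower (ν x : ℝ) (j : ℕ) :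
    4 * ν * (j + 1 + ν) * ((1 - x ^ 2) * (gegenbauerRec (ν + 1) j).eval x) =
      (j + 2 * ν) * (j + 1 + 2 * ν) * (gegenbauerRec ν j).eval x
        - (j + 1) * (j + 2) * (gegenbauerRec ν (j + 2)).eval x := by
  match j with
  | 0 =>
    have hC := gegenbauerRec_succ_succ_eval ν x 0
    simp only [zero_add, gegenbauerRec_zero_eval, gegenbauerRec_one_eval] at hC ⊢
    push_cast at hC ⊢
    linear_combination hC
  | 1 =>
    have hC := gegenbauerRec_succ_succ_eval ν x 1
    obtain ⟨h1, h2⟩ := gegenbauerRec_raise ν x 0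
    simp only [zero_add, gegenbauerRec_zero_eval, gegenbauerRec_one_eval, Nat.reduceAdd]
      at hC h1 h2 ⊢
    push_cast at hC h1 h2 ⊢
    linear_combination 2 * hC + 2 * (2 + ν) * x * h1
  | m + 2 =>
    have hC := gegenbauerRec_succ_succ_eval ν x (m + 2)
    obtain ⟨-, h2⟩ := gegenbauerRec_raise ν x m
    obtain ⟨h1, -⟩ := gegenbauerRec_raise ν x (m + 1)
    push_cast at hC h1 h2 ⊢
    linear_combination ((m : ℝ) + 3) * hC + 2 * ((m : ℝ) + 3 + ν) * x * h1
      - 2 * ((m : ℝ) + 3 + ν) * h2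

/-- The value at `x` of `2^i (α)_i C_j^{α+i}`, which is the `i`-th derivative of `C_{i+j}^α`. -/
noncomputable def gegenbauerDeriv (α : ℝ) (i j : ℕ) (x : ℝ) : ℝ :=
  2 ^ i * (ascPochhammer ℝ i).eval α * (gegenbauerRec (α + i) j).eval x

theorem gegenbauerDeriv_one (α : ℝ) (i : ℕ) (x : ℝ) :
    gegenbauerDeriv α i 1 x = 2 * (α + i) * x * gegenbauerDeriv α i 0 x := by
  simp only [gegenbauerDeriv, gegenbauerRec_one_eval, gegenbauerRec_zero_eval]
  ring

theorem gegenbauerDeriv_succ_zero (α : ℝ) (i : ℕ) (x : ℝ) :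
    gegenbauerDeriv α (i + 1) 0 x = 2 * (α + i) * gegenbauerDeriv α i 0 x := by
  simp only [gegenbauerDeriv, gegenbauerRec_zero_eval, ascPochhammer_succ_eval]
  ring

theorem gegenbauerDeriv_succ_one (α : ℝ) (i : ℕ) (x : ℝ) :
    gegenbauerDeriv α (i + 1) 1 x = 2 * (α + i + 1) * gegenbauerDeriv α i 1 x := by
  simp only [gegenbauerDeriv, gegenbauerRec_one_eval, ascPochhammer_succ_eval]
  push_cast
  ring

theorem gegenbauerDeriv_rec (α : ℝ) (i j : ℕ) (x : ℝ) :
    2 * (j + 1 + α + i) * (x * gegenbauerDeriv α i (j + 1) x) =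
      (j + 2) * gegenbauerDeriv α i (j + 2) x
        + (j + 2 * α + 2 * i) * gegenbauerDeriv α i j x := by
  have h := gegenbauerRec_succ_succ_eval (α + i) x j
  simp only [gegenbauerDeriv]
  linear_combination -(2 ^ i * (ascPochhammer ℝ i).eval α) * h

theorem gegenbauerDeriv_raise (α : ℝ) (i j : ℕ) (x : ℝ) :
    2 * (j + 2 + α + i) * gegenbauerDeriv α i (j + 2) x =
      gegenbauerDeriv α (i + 1) (j + 2) x - gegenbauerDeriv α (i + 1) j x := by
  have h := gegenbauerRec_raise_sub (α + i) x j
  simp only [gegenbauerDeriv, ascPochhammer_succ_eval]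
  push_cast
  rw [← add_assoc α (i : ℝ) 1]
  linear_combination (2 ^ (i + 1) * (ascPochhammer ℝ i).eval α) * h

theorem gegenbauerDeriv_lower (α : ℝ) (i j : ℕ) (x : ℝ) :
    2 * (j + 1 + α + i) * ((1 - x ^ 2) * gegenbauerDeriv α (i + 1) j x) =
      (j + 2 * α + 2 * i) * (j + 1 + 2 * α + 2 * i) * gegenbauerDeriv α i j x
        - (j + 1) * (j + 2) * gegenbauerDeriv α i (j + 2) x := by
  have h := gegenbauerRec_lower (α + i) x j
  simp only [gegenbauerDeriv, ascPochhammer_succ_eval]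
  push_cast
  rw [← add_assoc α (i : ℝ) 1]
  linear_combination (2 ^ i * (ascPochhammer ℝ i).eval α) * h

/-! ### The coefficients of the addition formula and their recursion in the degree -/

/-- The weight `(k - i)! / (2α)_{k+i}` of the `i`-th summand of the addition formula. -/
noncomputable def additionWeight (α : ℝ) (k i : ℕ) : ℝ :=
  ((k - i).factorial : ℝ) / (ascPochhammer ℝ (k + i)).eval (2 * α)

/-- The coefficient of the `i`-th polynomial in the angular variable in the addition formula for
`C_k^α`, extended by `0` to `i > k`. -/
noncomputable def additionCoeff (α a b : ℝ) (k i : ℕ) : ℝ :=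
  if i ≤ k then
    additionWeight α k i * (gegenbauerDeriv α i (k - i) a * gegenbauerDeriv α i (k - i) b)
  else 0

theorem additionCoeff_add (α a b : ℝ) (i j : ℕ) :
    additionCoeff α a b (i + j) i =
      (j.factorial : ℝ) / (ascPochhammer ℝ (2 * i + j)).eval (2 * α)
        * (gegenbauerDeriv α i j a * gegenbauerDeriv α i j b) := by
  rw [additionCoeff, if_pos (by omega), additionWeight, Nat.add_sub_cancel_left,
    show i + j + i = 2 * i + j by omega]

theorem additionCoeff_eq_zero (α a b : ℝ) {k i : ℕ} (h : k < i) : additionCoeff α a b k i = 0 :=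
  if_neg (by omega)

/-- The ratio `i / (2i + 2α - 1)`. The coefficients of the three-term recursion of the angular
factors, which express `g t E_i` through `E_{i+1}` and `g² E_{i-1}`, are `angularCoeff α (i + 1)`
and `1 - angularCoeff α (i - 1)`. For `α = 1/2` and
`i = 0` the division by zero yields the right value `0`. -/
noncomputable def angularCoeff (α : ℝ) (i : ℕ) : ℝ := i / (2 * i + 2 * α - 1)

theorem angularCoeff_zero (α : ℝ) : angularCoeff α 0 = 0 := by simp [angularCoeff]

theorem angularCoeff_mul {α : ℝ} (hα : 1 / 2 ≤ α) (i : ℕ) :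
    angularCoeff α i * (2 * i + 2 * α - 1) = i := by
  rcases Nat.eq_zero_or_pos i with rfl | hi
  · simp [angularCoeff]
  · have : (1 : ℝ) ≤ i := by exact_mod_cast hi
    exact div_mul_cancel₀ _ (by linarith)

/-- The recursion in the degree `k` that the coefficients of the addition formula have to satisfy.
The products in the variables `a` and `b` expand over degrees `j` and `j - 2`, where
`j = k + 2 - i`; the mixed terms cancel. -/
theorem additionCoeff_rec {α : ℝ} (hα : 1 / 2 ≤ α) (a b : ℝ) (k i : ℕ) :
    ((k : ℝ) + 2) * additionCoeff α a b (k + 2) i =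
      2 * (k + 1 + α) * (a * b * additionCoeff α a b (k + 1) i
        + angularCoeff α i * additionCoeff α a b (k + 1) (i - 1)
        + (1 - angularCoeff α i) * ((1 - a ^ 2) * (1 - b ^ 2))
          * additionCoeff α a b (k + 1) (i + 1))
      - (k + 2 * α) * additionCoeff α a b k i := by
  have hA := angularCoeff_mul hα i
  rcases lt_or_ge (k + 2) i with h | h
  · rw [additionCoeff_eq_zero _ _ _ h, additionCoeff_eq_zero _ _ _ (by omega : k + 1 < i),
      additionCoeff_eq_zero _ _ _ (by omega : k + 1 < i - 1),
      additionCoeff_eq_zero _ _ _ (by omega : k + 1 < i + 1),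
      additionCoeff_eq_zero _ _ _ (by omega : k < i)]
    ring
  obtain ⟨j, hj⟩ := Nat.exists_eq_add_of_le h
  match j, hj with
  | 0, hj =>
    obtain ⟨m, rfl⟩ : ∃ m, i = m + 1 := ⟨i - 1, by omega⟩
    obtain rfl : m = k + 1 := by omega
    rw [additionCoeff_eq_zero _ _ _ (by omega : k + 1 < k + 1 + 1),
      additionCoeff_eq_zero _ _ _ (by omega : k + 1 < k + 1 + 1 + 1),
      additionCoeff_eq_zero _ _ _ (by omega : k < k + 1 + 1), Nat.add_sub_cancel]
    have e1 := additionCoeff_add α a b (k + 2) 0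
    have e2 := additionCoeff_add α a b (k + 1) 0
    rw [add_zero] at e1 e2
    rw [show k + 1 + 1 = k + 2 from rfl, e1, e2,
      show 2 * (k + 2) + 0 = 2 * (k + 1) + 0 + 1 + 1 by ring,
      ascPochhammer_succ_eval, ascPochhammer_succ_eval]
    have hp := ascPochhammer_pos (2 * (k + 1) + 0) (2 * α) (by linarith)
    rw [gegenbauerDeriv_succ_zero α (k + 1) a, gegenbauerDeriv_succ_zero α (k + 1) b]
    generalize eval (2 * α) (ascPochhammer ℝ (2 * (k + 1) + 0)) = p at hp ⊢
    push_cast at hA ⊢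
    have hA' : angularCoeff α (k + 1 + 1) = (k + 2) / (2 * k + 2 * α + 3) := by
      rw [eq_div_iff (by positivity)]; linear_combination hA
    rw [hA']
    have : (0:ℝ) < α := by linarith
    field_simp
    ring
  | 1, hj =>
    obtain rfl : i = k + 1 := by omega
    rw [additionCoeff_eq_zero _ _ _ (by omega : k + 1 < k + 1 + 1),
      additionCoeff_eq_zero _ _ _ (by omega : k < k + 1), Nat.add_sub_cancel]
    have e1 := additionCoeff_add α a b (k + 1) 1
    have e2 := additionCoeff_add α a b (k + 1) 0
    have e3 := additionCoeff_add α a b k 1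
    rw [add_zero] at e2
    rw [show k + 2 = k + 1 + 1 from rfl, e1, e2, e3,
      show 2 * (k + 1) + 1 = 2 * k + 1 + 1 + 1 by ring,
      show 2 * (k + 1) + 0 = 2 * k + 1 + 1 by ring,
      ascPochhammer_succ_eval, ascPochhammer_succ_eval]
    have hp := ascPochhammer_pos (2 * k + 1) (2 * α) (by linarith)
    generalize eval (2 * α) (ascPochhammer ℝ (2 * k + 1)) = p at hp ⊢
    rw [gegenbauerDeriv_succ_one α k a, gegenbauerDeriv_succ_one α k b,
      gegenbauerDeriv_succ_zero α k a, gegenbauerDeriv_succ_zero α k b,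
      gegenbauerDeriv_one α k a, gegenbauerDeriv_one α k b]
    push_cast at hA ⊢
    have hA' : angularCoeff α (k + 1) = (k + 1) / (2 * k + 2 * α + 1) := by
      rw [eq_div_iff (by positivity)]; linear_combination hA
    rw [hA']
    have : (0:ℝ) < α := by linarith
    field_simp
    ring
  | j + 2, hj =>
    obtain rfl : k = i + j := by omega
    have hα0 : 0 < α := by linarith
    have hN : 2 * ((i : ℝ) + j + 1 + α) ≠ 0 := by positivity
    obtain ⟨s, hs⟩ : ∃ s : ℝ, s = j + 2 * α + 2 * i := ⟨_, rfl⟩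
    have hs0 : 0 < s := by rw [hs]; positivity
    have hp := ascPochhammer_pos (2 * i + j) (2 * α) (by linarith)
    have hp1 := ascPochhammer_succ_eval (2 * i + j) (2 * α)
    have hp2 := ascPochhammer_succ_eval (2 * i + j + 1) (2 * α)
    obtain ⟨p, hpe⟩ : ∃ p, eval (2 * α) (ascPochhammer ℝ (2 * i + j)) = p := ⟨_, rfl⟩
    rw [hpe] at hp hp1
    rw [hp1] at hp2
    push_cast at hp1 hp2
    rw [show 2 * α + (2 * (i : ℝ) + j) = s by rw [hs]; ring] at hp1 hp2
    rw [show 2 * α + (2 * (i : ℝ) + j + 1) = s + 1 by rw [hs]; ring] at hp2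
    -- all five weights are polynomial multiples of the smallest one
    obtain ⟨u, hu⟩ : ∃ u : ℝ, u = (j.factorial : ℝ) / (p * s * (s + 1)) := ⟨_, rfl⟩
    have w₂ : additionCoeff α a b (i + j + 2) i = ((j : ℝ) + 2) * (j + 1) * u
        * (gegenbauerDeriv α i (j + 2) a * gegenbauerDeriv α i (j + 2) b) := by
      rw [show i + j + 2 = i + (j + 2) by ring, additionCoeff_add,
        show 2 * i + (j + 2) = 2 * i + j + 1 + 1 by ring, hp2, hu, Nat.factorial_succ,
        Nat.factorial_succ]
      push_cast
      ring
    have w₁ : additionCoeff α a b (i + j + 1) i = ((j : ℝ) + 1) * (s + 1) * u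
        * (gegenbauerDeriv α i (j + 1) a * gegenbauerDeriv α i (j + 1) b) := by
      rw [show i + j + 1 = i + (j + 1) by ring, additionCoeff_add,
        show 2 * i + (j + 1) = 2 * i + j + 1 by ring, hp1, hu, Nat.factorial_succ]
      push_cast
      field_simp
    have w₀ : additionCoeff α a b (i + j) i = s * (s + 1) * u
        * (gegenbauerDeriv α i j a * gegenbauerDeriv α i j b) := by
      rw [additionCoeff_add, hpe, hu]
      field_simp
    have wsucc : additionCoeff α a b (i + j + 1) (i + 1) = u
        * (gegenbauerDeriv α (i + 1) j a * gegenbauerDeriv α (i + 1) j b) := by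
      rw [show i + j + 1 = i + 1 + j by ring, additionCoeff_add,
        show 2 * (i + 1) + j = 2 * i + j + 1 + 1 by ring, hp2, hu]
    have wpred : angularCoeff α i * ((2 * ((i : ℝ) + j + 1 + α)) ^ 2
          * additionCoeff α a b (i + j + 1) (i - 1)) =
        angularCoeff α i * (((j : ℝ) + 2) * (j + 1) * (s * (s + 1)) * u
          * ((gegenbauerDeriv α i (j + 2) a - gegenbauerDeriv α i j a)
            * (gegenbauerDeriv α i (j + 2) b - gegenbauerDeriv α i j b))) := by
      rcases i with _ | m
      · simp [angularCoeff_zero]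
      · rw [← gegenbauerDeriv_raise, ← gegenbauerDeriv_raise, Nat.add_sub_cancel,
          show m + 1 + j + 1 = m + (j + 2) by ring, additionCoeff_add,
          show 2 * m + (j + 2) = 2 * (m + 1) + j by ring, hpe, hu, Nat.factorial_succ,
          Nat.factorial_succ]
        congr 1
        push_cast
        field_simp
        ring
    have ra := gegenbauerDeriv_rec α i j a
    have rb := gegenbauerDeriv_rec α i j b
    have la := gegenbauerDeriv_lower α i j a
    have lb := gegenbauerDeriv_lower α i j b
    have hN' : 2 * ((j : ℝ) + 1 + α + i) = 2 * ((i : ℝ) + j + 1 + α) := by ring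
    have hs' : (j : ℝ) + 1 + 2 * α + 2 * i = s + 1 := by rw [hs]; ring
    rw [hN', ← hs] at ra rb la lb
    rw [hs'] at la lb
    have rr := congrArg₂ (· * ·) ra rb
    have ll := congrArg₂ (· * ·) la lb
    refine mul_left_cancel₀ hN ?_
    rw [w₂, w₁, w₀, wsucc]
    push_cast
    generalize gegenbauerDeriv α i (j + 2) a = P at *
    generalize gegenbauerDeriv α i (j + 2) b = Q at *
    generalize gegenbauerDeriv α i j a = P' at *
    generalize gegenbauerDeriv α i j b = Q' at *
    generalize angularCoeff α i = A at *
    rw [hs] at rr ll wpred ⊢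
    linear_combination (-((j : ℝ) + 1) * (j + 2 * α + 2 * i + 1) * u) * rr - wpred
      - (1 - A) * u * ll
      - (u * (2 * ((i : ℝ) + j + 1 + α)) * (((j : ℝ) + 1) * (j + 2) * P * Q
        - (j + 2 * α + 2 * i) * (j + 2 * α + 2 * i + 1) * P' * Q')) * hA

/-! ### The polynomials in the angular variable -/

/-- The factor `(i + μ) / μ` for `μ ≠ 0`. At `μ = 0` it is `1` for `i = 0` and `2` for `i ≥ 1`,
because `(i + μ) / μ * C_i^μ` tends to `2 T_i` as `μ → 0`. -/
noncomputable def angularScale (μ : ℝ) (i : ℕ) : ℝ :=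
  if i = 0 then 1 else if μ = 0 then 2 else (i + μ) / μ

theorem angularScale_pos {μ : ℝ} (hμ : 0 ≤ μ) (i : ℕ) : 0 < angularScale μ i := by
  unfold angularScale
  split_ifs with hi h
  · exact one_pos
  · exact two_pos
  · have : 0 < μ := lt_of_le_of_ne hμ (Ne.symm h)
    positivity

/-- The rescaled and homogenized polynomial `g^i (i + μ) / μ C_i^μ(t)` in the angular variable. In
this normalization the order `μ = 0` needs no separate treatment in the addition formula. -/
noncomputable def angularFactor (μ g t : ℝ) (i : ℕ) : ℝ :=
  angularScale μ i * (g ^ i * (gegenbauer μ i).eval t)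

theorem angularFactor_zero (μ g t : ℝ) : angularFactor μ g t 0 = 1 := by
  by_cases h : μ = 0 <;> simp [angularFactor, angularScale, gegenbauer, gegenbauerRec, h]

/-- The initial case of the three-term recursion of the angular factors, which lacks the term of
lower degree. -/
theorem mul_angularFactor_zero {μ : ℝ} (hμ : 0 ≤ μ) (g t : ℝ) :
    g * t * angularFactor μ g t 0 = angularCoeff (μ + 1 / 2) 1 * angularFactor μ g t 1 := by
  rw [angularFactor_zero]
  rcases hμ.eq_or_lt with rfl | h
  · simp [angularFactor, angularScale, gegenbauer, angularCoeff]
  · have hA : angularCoeff (μ + 1 / 2) 1 = 1 / (2 * (1 + μ)) := by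
      simp only [angularCoeff]
      push_cast
      ring_nf
    rw [hA]
    simp only [angularFactor, angularScale, gegenbauer, h.ne', if_false,
      one_ne_zero, gegenbauerRec_one_eval, pow_one, Nat.cast_one]
    field_simp

/-- The three-term recursion of the angular factors. -/
theorem mul_angularFactor_succ {μ : ℝ} (hμ : 0 ≤ μ) (g t : ℝ) (i : ℕ) :
    g * t * angularFactor μ g t (i + 1) =
      angularCoeff (μ + 1 / 2) (i + 2) * angularFactor μ g t (i + 2)
        + (1 - angularCoeff (μ + 1 / 2) i) * g ^ 2 * angularFactor μ g t i := by
  have hA2 : angularCoeff (μ + 1 / 2) (i + 2) = (i + 2) / (2 * (i + 2 + μ)) := by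
    simp only [angularCoeff]
    push_cast
    ring_nf
  have hA : angularCoeff (μ + 1 / 2) i = i / (2 * (i + μ)) := by
    simp only [angularCoeff]
    ring_nf
  rw [hA2, hA]
  rcases hμ.eq_or_lt with rfl | h
  · have hT := congrArg (eval t) (Chebyshev.T_add_two ℝ (i : ℤ))
    simp only [eval_sub, eval_mul, eval_ofNat, eval_X] at hT
    simp only [angularFactor, angularScale, gegenbauer, if_true]
    push_cast
    rw [hT]
    rcases i with _ | m
    · simp
      ring
    · simp only [Nat.add_eq_zero_iff, one_ne_zero, and_false, if_false]
      push_cast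
      field_simp
      ring
  · have hC := gegenbauerRec_succ_succ_eval μ t i
    have hC' : (gegenbauerRec μ (i + 2)).eval t =
        (2 * (i + 1 + μ) * t * (gegenbauerRec μ (i + 1)).eval t
          - (i + 2 * μ) * (gegenbauerRec μ i).eval t) / (i + 2) := by
      rw [eq_div_iff (by positivity)]
      linear_combination hC
    simp only [angularFactor, angularScale, gegenbauer, h.ne', if_false]
    rw [hC']
    rcases i with _ | m
    · simp
      field_simp
      ring
    · simp only [Nat.add_eq_zero_iff, one_ne_zero, OfNat.ofNat_ne_zero, and_false, if_false]
      push_cast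
      field_simp
      ring

/-! ### The addition formula -/

open Finset in
/-- The addition formula, with an angular variable `t` and a number `g` that plays the role of
`√(1 - a²) √(1 - b²)`. -/
theorem gegenbauerRec_addition {μ : ℝ} (hμ : 0 ≤ μ) {a b g : ℝ} (t : ℝ)
    (hg : g ^ 2 = (1 - a ^ 2) * (1 - b ^ 2)) (k : ℕ) :
    (gegenbauerRec (μ + 1 / 2) k).eval (a * b + g * t) =
      ∑ i ∈ range (k + 1), additionCoeff (μ + 1 / 2) a b k i * angularFactor μ g t i := by
  set α := μ + 1 / 2 with hα
  have hα' : 1 / 2 ≤ α := by linarith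
  have w00 : additionCoeff α a b 0 0 = 1 := by
    simp [additionCoeff, additionWeight, gegenbauerDeriv, gegenbauerRec]
  have w10 : additionCoeff α a b 1 0 = 2 * α * a * b := by
    simp [additionCoeff, additionWeight, gegenbauerDeriv, gegenbauerRec]
    field_simp
  have w11 : additionCoeff α a b 1 1 = 2 * α / (2 * α + 1) := by
    have e : (ascPochhammer ℝ 2).eval (2 * α) = 2 * α * (2 * α + 1) := by
      rw [ascPochhammer_succ_eval]
      simp
    simp [additionCoeff, additionWeight, gegenbauerDeriv, gegenbauerRec, e]
    field_simp
  induction k using Nat.strong_induction_on with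
  | _ k ih =>
    match k, ih with
    | 0, _ => simp [gegenbauerRec, w00, angularFactor_zero]
    | 1, _ =>
      have h0 := mul_angularFactor_zero hμ g t
      rw [angularFactor_zero, ← hα] at h0
      have hA : angularCoeff α 1 = 1 / (2 * α + 1) := by
        simp only [angularCoeff]
        push_cast
        ring_nf
      rw [hA] at h0
      rw [gegenbauerRec_one_eval, sum_range_succ, sum_range_one, w10, w11, angularFactor_zero]
      linear_combination 2 * α * h0
    | k + 2, ih =>
      have hk : (k : ℝ) + 2 ≠ 0 := by positivity
      refine mul_left_cancel₀ hk ?_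
      rw [gegenbauerRec_succ_succ_eval, ih (k + 1) (by omega), ih k (by omega)]
      have s0 : ∑ i ∈ range (k + 1), additionCoeff α a b k i * angularFactor μ g t i =
          ∑ i ∈ range (k + 2 + 1), additionCoeff α a b k i * angularFactor μ g t i := by
        rw [sum_range_succ _ (k + 2), sum_range_succ _ (k + 1),
          additionCoeff_eq_zero _ _ _ (by omega : k < k + 1),
          additionCoeff_eq_zero _ _ _ (by omega : k < k + 2)]
        simp
      have s1 : ∑ i ∈ range (k + 1 + 1), additionCoeff α a b (k + 1) i * angularFactor μ g t i =
          ∑ i ∈ range (k + 2 + 1), additionCoeff α a b (k + 1) i * angularFactor μ g t i := by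
        rw [sum_range_succ _ (k + 2), additionCoeff_eq_zero _ _ _ (by omega : k + 1 < k + 2)]
        simp
      -- multiplication by `g * t` acts by the three-term recursion of the angular factors
      have s2 : g * t * ∑ i ∈ range (k + 1 + 1),
            additionCoeff α a b (k + 1) i * angularFactor μ g t i =
          ∑ i ∈ range (k + 2 + 1), (angularCoeff α i * additionCoeff α a b (k + 1) (i - 1)
            + (1 - angularCoeff α i) * ((1 - a ^ 2) * (1 - b ^ 2))
              * additionCoeff α a b (k + 1) (i + 1)) * angularFactor μ g t i := by
        simp only [add_mul _ _ (angularFactor μ g t _)]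
        have up : ∑ i ∈ range (k + 2 + 1),
              angularCoeff α i * additionCoeff α a b (k + 1) (i - 1) * angularFactor μ g t i =
            ∑ i ∈ range (k + 1), angularCoeff α (i + 1 + 1)
                * additionCoeff α a b (k + 1) (i + 1 + 1 - 1) * angularFactor μ g t (i + 1 + 1)
              + angularCoeff α 1 * additionCoeff α a b (k + 1) 0 * angularFactor μ g t 1 := by
          rw [sum_range_succ', sum_range_succ', angularCoeff_zero]
          simp
        have down : ∑ i ∈ range (k + 2 + 1),
              (1 - angularCoeff α i) * ((1 - a ^ 2) * (1 - b ^ 2))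
                * additionCoeff α a b (k + 1) (i + 1) * angularFactor μ g t i =
            ∑ i ∈ range (k + 1), (1 - angularCoeff α i) * ((1 - a ^ 2) * (1 - b ^ 2))
                * additionCoeff α a b (k + 1) (i + 1) * angularFactor μ g t i := by
          rw [sum_range_succ, sum_range_succ,
            additionCoeff_eq_zero _ _ _ (by omega : k + 1 < k + 1 + 1),
            additionCoeff_eq_zero _ _ _ (by omega : k + 1 < k + 2 + 1)]
          simp
        rw [sum_add_distrib, up, down, sum_range_succ', mul_add, mul_sum]
        have h0 := mul_angularFactor_zero hμ g t
        rw [← hα] at h0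
        have : ∀ i ∈ range (k + 1),
            g * t * (additionCoeff α a b (k + 1) (i + 1) * angularFactor μ g t (i + 1)) =
              angularCoeff α (i + 1 + 1) * additionCoeff α a b (k + 1) (i + 1 + 1 - 1)
                  * angularFactor μ g t (i + 1 + 1)
                + (1 - angularCoeff α i) * ((1 - a ^ 2) * (1 - b ^ 2))
                  * additionCoeff α a b (k + 1) (i + 1) * angularFactor μ g t i := by
          intro i _
          have h1 := mul_angularFactor_succ hμ g t i
          rw [← hα, hg] at h1
          rw [Nat.add_sub_cancel]
          linear_combination additionCoeff α a b (k + 1) (i + 1) * h1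
        rw [sum_congr rfl this, sum_add_distrib]
        linear_combination additionCoeff α a b (k + 1) 0 * h0
      have key : ((k : ℝ) + 2) * ∑ i ∈ range (k + 2 + 1),
            additionCoeff α a b (k + 2) i * angularFactor μ g t i =
          ∑ i ∈ range (k + 2 + 1), (2 * (k + 1 + α) * (a * b * additionCoeff α a b (k + 1) i
              + angularCoeff α i * additionCoeff α a b (k + 1) (i - 1)
              + (1 - angularCoeff α i) * ((1 - a ^ 2) * (1 - b ^ 2))
                * additionCoeff α a b (k + 1) (i + 1))
            - (k + 2 * α) * additionCoeff α a b k i) * angularFactor μ g t i := by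
        rw [mul_sum]
        exact sum_congr rfl fun i _ => by rw [← mul_assoc, additionCoeff_rec hα']
      have expand : 2 * ((k : ℝ) + 1 + α) * (a * b + g * t)
            * ∑ i ∈ range (k + 1 + 1), additionCoeff α a b (k + 1) i * angularFactor μ g t i =
          2 * (k + 1 + α) * (a * b * ∑ i ∈ range (k + 1 + 1),
              additionCoeff α a b (k + 1) i * angularFactor μ g t i
            + g * t * ∑ i ∈ range (k + 1 + 1),
              additionCoeff α a b (k + 1) i * angularFactor μ g t i) := by ring
      rw [key, expand, s2, s1, s0, mul_sum, mul_sum, ← sum_add_distrib, mul_sum, ← sum_sub_distrib]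
      refine sum_congr rfl fun i _ => ?_
      ring

/-! ### Projections and the spherical law of cosines -/

theorem span_range_augment {n r : ℕ} (Z : Fin r → EuclideanSpace ℝ (Fin n))
    (q : EuclideanSpace ℝ (Fin n)) :
    Submodule.span ℝ (Set.range (augment Z q)) =
      Submodule.span ℝ {q} ⊔ Submodule.span ℝ (Set.range Z) := by
  rw [← Submodule.span_union, augment, Fin.range_snoc, Set.singleton_union]

/-- Projecting away one more vector `q` is one more Gram–Schmidt step. -/
theorem starProjection_augment {n r : ℕ} (Z : Fin r → EuclideanSpace ℝ (Fin n))
    {q : EuclideanSpace ℝ (Fin n)} (hq : projInner Z q q ≠ 0) (x : EuclideanSpace ℝ (Fin n)) :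
    (Submodule.span ℝ (Set.range (augment Z q)))ᗮ.starProjection x =
      (Submodule.span ℝ (Set.range Z))ᗮ.starProjection x
        - (projInner Z x q / projInner Z q q) •
          (Submodule.span ℝ (Set.range Z))ᗮ.starProjection q := by
  have hspan := span_range_augment Z q
  set V := Submodule.span ℝ (Set.range Z)
  set V' := Submodule.span ℝ (Set.range (augment Z q))
  have hVV' : V ≤ V' := hspan ▸ le_sup_right
  have hqV' : q ∈ V' := by
    rw [hspan]
    exact Submodule.mem_sup_left (Submodule.mem_span_singleton_self q)
  have hsub : ∀ z, z - Vᗮ.starProjection z ∈ V := fun z => by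
    rw [Submodule.starProjection_orthogonal_val, sub_sub_cancel]
    exact Submodule.starProjection_apply_mem _ _
  have hinner : ∀ z, inner ℝ q (Vᗮ.starProjection z) = projInner Z z q := fun z => by
    change _ = inner ℝ (Vᗮ.starProjection z) (Vᗮ.starProjection q)
    rw [real_inner_comm, ← Submodule.inner_starProjection_left_eq_right,
      Submodule.starProjection_eq_self_iff.mpr (Submodule.starProjection_apply_mem _ _)]
  refine Submodule.eq_starProjection_of_mem_orthogonal ?_ ?_
  · rw [hspan, ← Submodule.inf_orthogonal]
    refine ⟨?_, Submodule.sub_mem _ (Submodule.starProjection_apply_mem _ _)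
      (Submodule.smul_mem _ _ (Submodule.starProjection_apply_mem _ _))⟩
    rw [SetLike.mem_coe, Submodule.mem_orthogonal_singleton_iff_inner_right, inner_sub_right,
      inner_smul_right, hinner, hinner, div_mul_cancel₀ _ hq, sub_self]
  · refine V'.le_orthogonal_orthogonal ?_
    rw [← sub_add]
    refine V'.add_mem (hVV' (hsub x)) (V'.smul_mem _ ?_)
    rw [← sub_sub_cancel q (Vᗮ.starProjection q)]
    exact V'.sub_mem hqV' (hVV' (hsub q))

theorem projInner_comm {n r : ℕ} (Z : Fin r → EuclideanSpace ℝ (Fin n))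
    (x y : EuclideanSpace ℝ (Fin n)) : projInner Z x y = projInner Z y x :=
  real_inner_comm _ _

theorem projInner_augment {n r : ℕ} (Z : Fin r → EuclideanSpace ℝ (Fin n))
    {q : EuclideanSpace ℝ (Fin n)} (hq : projInner Z q q ≠ 0) (x y : EuclideanSpace ℝ (Fin n)) :
    projInner (augment Z q) x y =
      projInner Z x y - projInner Z x q * projInner Z y q / projInner Z q q := by
  have h : projInner (augment Z q) x y = projInner Z x y
      - projInner Z y q / projInner Z q q * projInner Z x q
      - projInner Z x q / projInner Z q q * projInner Z q y
      + projInner Z x q / projInner Z q q * (projInner Z y q / projInner Z q q)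
        * projInner Z q q := by
    conv_lhs => rw [projInner, starProjection_augment Z hq, starProjection_augment Z hq]
    rw [inner_sub_left, inner_sub_right, inner_sub_right, real_inner_smul_left,
      real_inner_smul_left, real_inner_smul_right, real_inner_smul_right]
    simp only [← projInner.eq_1]
    ring
  rw [h, projInner_comm Z q y]
  field_simp
  ring

theorem projInner_self_nonneg {n r : ℕ} (Z : Fin r → EuclideanSpace ℝ (Fin n))
    (x : EuclideanSpace ℝ (Fin n)) : 0 ≤ projInner Z x x :=
  real_inner_self_nonneg

theorem projInner_self_pos {n r : ℕ} {Z : Fin r → EuclideanSpace ℝ (Fin n)}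
    {x : EuclideanSpace ℝ (Fin n)} (hx : x ∉ Submodule.span ℝ (Set.range Z)) :
    0 < projInner Z x x := by
  refine real_inner_self_pos.mpr fun h => hx ?_
  rw [Submodule.starProjection_orthogonal_val, sub_eq_zero] at h
  rw [h]
  exact Submodule.starProjection_apply_mem _ _

theorem projInner_mul_self_le {n r : ℕ} (Z : Fin r → EuclideanSpace ℝ (Fin n))
    (x y : EuclideanSpace ℝ (Fin n)) :
    projInner Z x y * projInner Z x y ≤ projInner Z x x * projInner Z y y :=
  real_inner_mul_inner_self_le _ _

/-- The square of the sine of the angle between the projections of `x` and `q`. -/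
theorem projInner_augment_self_div {n r : ℕ} (Z : Fin r → EuclideanSpace ℝ (Fin n))
    {x q : EuclideanSpace ℝ (Fin n)} (hx : 0 < projInner Z x x) (hq : 0 < projInner Z q q) :
    projInner (augment Z q) x x / projInner Z x x =
      1 - (projInner Z x q / (√(projInner Z x x) * √(projInner Z q q))) ^ 2 := by
  rw [projInner_augment Z hq.ne', div_pow, mul_pow, Real.sq_sqrt hx.le, Real.sq_sqrt hq.le]
  field_simp

/-- The spherical law of cosines for the projections of `x`, `y` and `q`. If `x` or `y` lies in the
span of `[Z q]`, the angular term is `0` on both sides by the Cauchy–Schwarz inequality. -/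
theorem projInner_law_of_cosines {n r : ℕ} (Z : Fin r → EuclideanSpace ℝ (Fin n))
    {x y q : EuclideanSpace ℝ (Fin n)} (hx : 0 < projInner Z x x) (hy : 0 < projInner Z y y)
    (hq : 0 < projInner Z q q) :
    projInner Z x y / (√(projInner Z x x) * √(projInner Z y y)) =
      projInner Z x q / (√(projInner Z x x) * √(projInner Z q q))
          * (projInner Z y q / (√(projInner Z y y) * √(projInner Z q q)))
        + √(projInner (augment Z q) x x / projInner Z x x)
            * √(projInner (augment Z q) y y / projInner Z y y)
          * (projInner (augment Z q) x y
            / (√(projInner (augment Z q) x x) * √(projInner (augment Z q) y y))) := by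
  have hang : √(projInner (augment Z q) x x / projInner Z x x)
            * √(projInner (augment Z q) y y / projInner Z y y)
          * (projInner (augment Z q) x y
            / (√(projInner (augment Z q) x x) * √(projInner (augment Z q) y y))) =
      projInner (augment Z q) x y / (√(projInner Z x x) * √(projInner Z y y)) := by
    rw [Real.sqrt_div (projInner_self_nonneg _ _), Real.sqrt_div (projInner_self_nonneg _ _)]
    have hcs := projInner_mul_self_le (augment Z q) x y
    have hx' := Real.sq_sqrt (projInner_self_nonneg (augment Z q) x)
    have hy' := Real.sq_sqrt (projInner_self_nonneg (augment Z q) y)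
    by_cases h : √(projInner (augment Z q) x x) * √(projInner (augment Z q) y y) = 0
    · have h0 : projInner (augment Z q) x y = 0 := by
        rw [← hx', ← hy', ← mul_pow, h] at hcs
        nlinarith
      rw [h0]
      simp
    · have := Real.sqrt_pos.mpr hx
      have := Real.sqrt_pos.mpr hy
      obtain ⟨h1, h2⟩ := mul_ne_zero_iff.mp h
      field_simp
  rw [hang, projInner_augment Z hq.ne']
  have := Real.sqrt_pos.mpr hx
  have := Real.sqrt_pos.mpr hy
  have hq0 := Real.sqrt_pos.mpr hq
  have hq' := Real.sq_sqrt hq.le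
  field_simp
  rw [hq']
  ring

/-- At `i = 0` the two powers are `1`, also when their base is `0`. If `projInner (augment Z q) x x`
or `projInner (augment Z q) y y` vanishes, the undefined argument of the degree-`i` polynomial is
read as `0`; it does not matter, since for `i ≥ 1` one of the powers is then `0`. -/
theorem proposition4 (n r : ℕ) (hnr : r + 3 ≤ n) :
    ∃ c : ℕ → ℕ → ℝ, (∀ k i : ℕ, i ≤ k → 0 < c k i) ∧
      ∀ (k : ℕ) (x y q : EuclideanSpace ℝ (Fin n)) (Z : Fin r → EuclideanSpace ℝ (Fin n)),
        x ∈ Metric.sphere (0 : EuclideanSpace ℝ (Fin n)) 1 →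
        y ∈ Metric.sphere (0 : EuclideanSpace ℝ (Fin n)) 1 →
        q ∈ Metric.sphere (0 : EuclideanSpace ℝ (Fin n)) 1 →
        (∀ j, Z j ∈ Metric.sphere (0 : EuclideanSpace ℝ (Fin n)) 1) →
        x ∉ Submodule.span ℝ (Set.range Z) →
        y ∉ Submodule.span ℝ (Set.range Z) →
        q ∉ Submodule.span ℝ (Set.range Z) →
        (gegenbauer (((n : ℝ) - r) / 2 - 1) k).eval
            (projInner Z x y / (√(projInner Z x x) * √(projInner Z y y))) =
          ∑ i ∈ Finset.range (k + 1),
            c k i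
              * (projInner (augment Z q) x x / projInner Z x x) ^ ((i : ℝ) / 2)
              * (projInner (augment Z q) y y / projInner Z y y) ^ ((i : ℝ) / 2)
              * (gegenbauer (((n : ℝ) - r) / 2 - 3 / 2) i).eval
                  (projInner (augment Z q) x y /
                    (√(projInner (augment Z q) x x) * √(projInner (augment Z q) y y)))
              * (gegenbauer (((n : ℝ) - r) / 2 + i - 1) (k - i)).eval
                  (projInner Z x q / (√(projInner Z x x) * √(projInner Z q q)))
              * (gegenbauer (((n : ℝ) - r) / 2 + i - 1) (k - i)).eval
                  (projInner Z y q / (√(projInner Z y y) * √(projInner Z q q))) := by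
  obtain ⟨μ, hμdef⟩ : ∃ μ : ℝ, μ = ((n : ℝ) - r) / 2 - 3 / 2 := ⟨_, rfl⟩
  have hμ : 0 ≤ μ := by
    have : (r : ℝ) + 3 ≤ n := by exact_mod_cast hnr
    linarith
  rw [← hμdef, show ((n : ℝ) - r) / 2 - 1 = μ + 1 / 2 by rw [hμdef]; ring]
  have horder : ∀ i : ℕ, ((n : ℝ) - r) / 2 + i - 1 = μ + 1 / 2 + i := fun i => by
    rw [hμdef]; ring
  simp only [horder]
  have hrec : ∀ i d : ℕ, gegenbauer (μ + 1 / 2 + i) d = gegenbauerRec (μ + 1 / 2 + i) d :=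
    fun i d => if_neg (by positivity)
  have hrec0 : ∀ d : ℕ, gegenbauer (μ + 1 / 2) d = gegenbauerRec (μ + 1 / 2) d :=
    fun d => if_neg (by positivity)
  simp only [hrec, hrec0]
  refine ⟨fun k i => additionWeight (μ + 1 / 2) k i
    * (2 ^ i * (ascPochhammer ℝ i).eval (μ + 1 / 2)) ^ 2 * angularScale μ i, ?_, ?_⟩
  · intro k i _
    have h1 := ascPochhammer_pos (k + i) (2 * (μ + 1 / 2)) (by positivity)
    have h2 := ascPochhammer_pos i (μ + 1 / 2) (by positivity)
    have h3 := angularScale_pos hμ i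
    have h4 : 0 < additionWeight (μ + 1 / 2) k i :=
      div_pos (by exact_mod_cast Nat.factorial_pos _) h1
    positivity
  · intro k x y q Z _ _ _ _ hxZ hyZ hqZ
    have hx := projInner_self_pos hxZ
    have hy := projInner_self_pos hyZ
    have hq := projInner_self_pos hqZ
    have hX : 0 ≤ projInner (augment Z q) x x / projInner Z x x :=
      div_nonneg (projInner_self_nonneg _ _) hx.le
    have hY : 0 ≤ projInner (augment Z q) y y / projInner Z y y :=
      div_nonneg (projInner_self_nonneg _ _) hy.le
    rw [projInner_law_of_cosines Z hx hy hq, gegenbauerRec_addition hμ]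
    · refine Finset.sum_congr rfl fun i hi => ?_
      rw [additionCoeff, if_pos (Finset.mem_range_succ_iff.mp hi), Real.rpow_div_two_eq_sqrt _ hX,
        Real.rpow_div_two_eq_sqrt _ hY, Real.rpow_natCast, Real.rpow_natCast, angularFactor,
        gegenbauerDeriv, gegenbauerDeriv, mul_pow (√_)]
      ring
    · rw [mul_pow, Real.sq_sqrt hX, Real.sq_sqrt hY, projInner_augment_self_div Z hx hq,
        projInner_augment_self_div Z hy hq]
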